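/- Let $n\ge 2$ and $B\ge 1$ be integers and let $\epsilon>0$. Let $\{P(t)\}_{t\ge 0}$ be real $n\times n$ matrices with $P_{ij}(t)\in[0,1]$, $P_{ii}(t)=1$, and $P_{ij}(t)\ge\epsilon$ whenever $P_{ij}(t)\ne 0$, such that for every integer $t\ge 0$ the matrix $\sum_{s=tB}^{(t+1)B-1}P(s)$ is irreducible (its directed graph is strongly connected). Let $\{R_{ij}(t): 1\le i,j\le n,\ t\ge 0\}$ be independent random variables with $R_{ij}(t)=1$ with probability $P_{ij}(t)$ and $R_{ij}(t)=0$ with probability $1-P_{ij}(t)$, and put $$W_{ij}(t)=\frac{R_{ij}(t)}{\sum_{k=1}^n R_{kj}(t)}.$$ For a fixed $x(0)\in\mathbb R^n$ and $y(0)=(1,\dots,1)'$ run the push-sum algorithm $x(t+1)=W(t)x(t)$, $y(t+1)=W(t)y(t)$ and let $z_i(t)=x_i(t)/y_i(t)$ and $\bar x=\frac1n\sum_{i=1}^n x_i(0)$. Let $p=\epsilon^{2(n-1)}$. Then for every $i\in\{1,\dots,n\}$ and every integer $t\ge B+\frac{2nB}{p}$, the expectation of $\ln|z_i(t+1)-\bar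 x|$ is well defined in $[-\infty,\infty)$ and $$\mathbb E\big[\ln|z_i(t+1)-\bar x|\big]\le c_0-c_1t,$$ where $$c_0=\ln\big(2\|x(0)\|_1\big)+\ln(n)\Big(\frac{nB}{p}+B\Big)+\ln 15,\qquad c_1=-\frac{p}{2nB}\ln\Big(1-\frac1{n^{4nB/p}}\Big).$$ Here $\|\cdot\|_1$ is the $1$-norm and $\ln 0=-\infty$. -/

import Mathlib

open MeasureTheory ProbabilityTheory

noncomputable section

namespace PushSum

/-- The natural logarithm of a nonnegative real as an extended real, with `ln 0 = -∞`. -/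
def eln (r : ℝ) : EReal := ENNReal.log (ENNReal.ofReal r)

/-- The expectation of the positive part of an extended-real random variable. -/
def posExpectation {Ω : Type*} [MeasurableSpace Ω] (μ : Measure Ω) (f : Ω → EReal) : ENNReal :=
  ∫⁻ ω, (f ω).toENNReal ∂μ

/-- The expectation of the negative part of an extended-real random variable. -/
def negExpectation {Ω : Type*} [MeasurableSpace Ω] (μ : Measure Ω) (f : Ω → EReal) : ENNReal :=
  ∫⁻ ω, (-f ω).toENNReal ∂μ

/-- The expectation `E[f⁺] - E[f⁻]` of an extended-real random variable; it is well defined with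
value in `[-∞, ∞)` as soon as `E[f⁺] < ∞`. -/
def expectation {Ω : Type*} [MeasurableSpace Ω] (μ : Measure Ω) (f : Ω → EReal) : EReal :=
  (posExpectation μ f : EReal) - (negExpectation μ f : EReal)

/-- The link probability matrices `P(t)`: entries in `[0,1]`, unit diagonal, nonzero entries at
least `ε > 0`, and irreducible sums over each of the windows `[tB, (t+1)B - 1]`, where `B > 0`. -/
structure IsBIrreducible {n : ℕ} (P : ℕ → Matrix (Fin n) (Fin n) ℝ) (ε : ℝ) (B : ℕ) : Prop where
  nonneg : ∀ t i j, 0 ≤ P t i j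
  le_one : ∀ t i j, P t i j ≤ 1
  diag : ∀ t i, P t i i = 1
  eps_pos : 0 < ε
  eps_le : ∀ t i j, P t i j ≠ 0 → ε ≤ P t i j
  window_pos : 0 < B
  irreducible : ∀ t, (∑ s ∈ Finset.Ico (t * B) ((t + 1) * B), P s).IsIrreducible

/-- The links `R_{ij}(t)` are independent over all `t, i, j`, and `R_{ij}(t)` is `1` with
probability `P_{ij}(t)` and `0` with probability `1 - P_{ij}(t)`. -/
structure IsIndepBernoulli {Ω : Type*} [MeasurableSpace Ω] (μ : Measure Ω) {n : ℕ}
    (P : ℕ → Matrix (Fin n) (Fin n) ℝ) (R : ℕ → Fin n → Fin n → Ω → ℝ) : Prop where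
  measurable : ∀ t i j, Measurable (R t i j)
  prob_one : ∀ t i j, μ {ω | R t i j ω = 1} = ENNReal.ofReal (P t i j)
  prob_zero : ∀ t i j, μ {ω | R t i j ω = 0} = ENNReal.ofReal (1 - P t i j)
  indep : iIndepFun (fun k : ℕ × Fin n × Fin n => R k.1 k.2.1 k.2.2) μ

/-- The weight matrices `W_{ij}(t) = R_{ij}(t) / ∑_k R_{kj}(t)`. -/
def weight {Ω : Type*} {n : ℕ} (R : ℕ → Fin n → Fin n → Ω → ℝ) (ω : Ω) (t : ℕ) :
    Matrix (Fin n) (Fin n) ℝ :=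
  Matrix.of fun i j => R t i j ω / ∑ k, R t k j ω

/-- The linear dynamics `v(t+1) = W(t) v(t)` started at `v(0)`. -/
def state {n : ℕ} (W : ℕ → Matrix (Fin n) (Fin n) ℝ) (v : Fin n → ℝ) : ℕ → Fin n → ℝ
  | 0 => v
  | t + 1 => (W t).mulVec (state W v t)

/-- The push-sum estimates `z_i(t) = x_i(t) / y_i(t)`, where `x(0)` is given and `y(0) = 1`. -/
def estimate {n : ℕ} (W : ℕ → Matrix (Fin n) (Fin n) ℝ) (x0 : Fin n → ℝ) (t : ℕ) (i : Fin n) : ℝ :=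
  state W x0 t i / state W (fun _ => 1) t i

/-- The average of the initial values. -/
def average {n : ℕ} (x0 : Fin n → ℝ) : ℝ := (∑ i, x0 i) / n

/-- `p = ε^(2(n-1))`. -/
def rateP (n : ℕ) (ε : ℝ) : ℝ := ε ^ (2 * (n - 1))

/-- `c₀ = ln (2 ‖x(0)‖₁) + ln n (nB/p + B) + ln 15`, which is `-∞` when `x(0) = 0`. -/
def c0 {n : ℕ} (ε : ℝ) (B : ℕ) (x0 : Fin n → ℝ) : EReal :=
  eln (2 * ∑ i, |x0 i|) +
    ((Real.log n * ((n : ℝ) * B / rateP n ε + B) + Real.log 15 : ℝ) : EReal)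

/-- `c₁ = -(p/(2nB)) ln (1 - 1/n^(4nB/p))`. -/
def c1 (n : ℕ) (ε : ℝ) (B : ℕ) : ℝ :=
  -(rateP n ε / (2 * n * B)) * Real.log (1 - 1 / (n : ℝ) ^ (4 * (n : ℝ) * B / rateP n ε))

end PushSum

end

namespace PushSum

/-! Since `x` and `y` obey the same linear recursion, `x - a y` and `b y - x` are trajectories too.
Almost surely every `W(t)` is nonnegative and column stochastic, so nonnegativity of both gaps
persists: an interval `[a, b]` containing all ratios keeps containing them. It also contains the
average, so `b - a` bounds the error.

Cut time into blocks of `n` windows. Irreducibility provides, for each block, at most `n * n`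
deterministic links whose joint presence spreads every node's mass to every node
(`exists_spreading_links`). The interval then shrinks by `1 - α`, with `α = n^(-nB) / n`
(`Brackets.contract`). By independence this has probability at least `ε^(n * n)`.

The log of the length is thus at most a constant plus a sum of indicators times `log (1 - α)`.
Linearity of expectation suffices, with no independence between blocks. `c1_mul_le` shows that the
resulting decay is at least `c₁ t`, up to an additive `1`. -/

/-- A nonnegative matrix whose columns sum to `1` and whose diagonal entries are at least `δ`. -/
structure IsLazyColStochastic {n : ℕ} (δ : ℝ) (M : Matrix (Fin n) (Fin n) ℝ) : Prop where
  nonneg : ∀ i j, 0 ≤ M i j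
  col_sum : ∀ j, ∑ i, M i j = 1
  diag : ∀ j, δ ≤ M j j

/-- In an irreducible matrix some positive entry enters a proper nonempty set of columns from a row
outside of it. -/
theorem exists_pos_entry_of_isIrreducible {n : ℕ} {A : Matrix (Fin n) (Fin n) ℝ}
    (hA : A.IsIrreducible) {S : Finset (Fin n)} (hS : S.Nonempty) (hS' : S ≠ Finset.univ) :
    ∃ a b, a ∉ S ∧ b ∈ S ∧ 0 < A a b := by
  obtain ⟨b, hb⟩ := hS
  obtain ⟨a, ha⟩ : ∃ a, a ∉ S := by
    by_contra! h
    exact hS' (Finset.eq_univ_iff_forall.2 h)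
  by_contra! hno
  -- A path from outside `S` to `b` in `S` must enter `S` along a positive entry. Paths run against
  -- the flow of mass, which goes from column to row.
  let : Quiver (Fin n) := A.toQuiver
  have key : ∀ (c : Fin n), Quiver.Path a c → c ∉ S := by
    intro c p
    induction p with
    | nil => exact ha
    | cons p e ih => exact fun hc => (hno _ _ ih hc).not_gt e.down
  obtain ⟨p, -⟩ := hA.connected a b
  exact key b p hb

/-! ### Nonnegative trajectories of the linear dynamics -/

section trajectories

variable {n : ℕ} {δ : ℝ} {W : ℕ → Matrix (Fin n) (Fin n) ℝ} {u : ℕ → Fin n → ℝ}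

theorem trajectory_nonneg (hW : ∀ t, IsLazyColStochastic δ (W t))
    (hu : ∀ t, u (t + 1) = (W t).mulVec (u t)) {s t : ℕ} (hst : s ≤ t) (h0 : ∀ i, 0 ≤ u s i) :
    ∀ i, 0 ≤ u t i := by
  induction t, hst using Nat.le_induction with
  | base => exact h0
  | succ t _ ih =>
    intro i
    rw [hu, Matrix.mulVec, dotProduct]
    exact Finset.sum_nonneg fun j _ => mul_nonneg ((hW t).nonneg i j) (ih j)

theorem mul_le_trajectory_succ (hW : ∀ t, IsLazyColStochastic δ (W t))
    (hu : ∀ t, u (t + 1) = (W t).mulVec (u t)) {t : ℕ} (h0 : ∀ i, 0 ≤ u t i) {a b : Fin n}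
    (hab : δ ≤ W t a b) : δ * u t b ≤ u (t + 1) a := by
  rw [hu]
  refine (mul_le_mul_of_nonneg_right hab (h0 b)).trans ?_
  exact Finset.single_le_sum (f := fun j => W t a j * u t j)
    (fun j _ => mul_nonneg ((hW t).nonneg a j) (h0 j)) (Finset.mem_univ b)

theorem pow_mul_le_trajectory (hδ : 0 ≤ δ) (hW : ∀ t, IsLazyColStochastic δ (W t))
    (hu : ∀ t, u (t + 1) = (W t).mulVec (u t)) {t : ℕ} (h0 : ∀ i, 0 ≤ u t i) (i : Fin n) (m : ℕ) :
    δ ^ m * u t i ≤ u (t + m) i := by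
  induction m with
  | zero => simp
  | succ m ih =>
    calc δ ^ (m + 1) * u t i = δ * (δ ^ m * u t i) := by ring
      _ ≤ δ * u (t + m) i := mul_le_mul_of_nonneg_left ih hδ
      _ ≤ u (t + (m + 1)) i :=
        mul_le_trajectory_succ hW hu (trajectory_nonneg hW hu (by omega) h0) ((hW _).diag i)

theorem sum_trajectory (hW : ∀ t, IsLazyColStochastic δ (W t))
    (hu : ∀ t, u (t + 1) = (W t).mulVec (u t)) (t : ℕ) : ∑ i, u t i = ∑ i, u 0 i := by
  induction t with
  | zero => rfl
  | succ t ih =>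
    rw [← ih, hu]
    simp only [Matrix.mulVec, dotProduct]
    rw [Finset.sum_comm]
    refine Finset.sum_congr rfl fun j _ => ?_
    rw [← Finset.sum_mul, (hW t).col_sum, one_mul]

end trajectories

/-! ### Spreading of mass along finitely many links -/

/-- Starting at the window `w`, there are `k` possible links whose simultaneous presence carries the
mass of node `j` to at least `min n (k + 1)` nodes within `k` windows. -/
theorem exists_spreading_links_from {n : ℕ} {P : ℕ → Matrix (Fin n) (Fin n) ℝ} {ε : ℝ} {B : ℕ}
    (hP : IsBIrreducible P ε B) (w : ℕ) (j : Fin n) (k : ℕ) :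
    ∃ (E : Finset (ℕ × Fin n × Fin n)) (S : Finset (Fin n)), E.card ≤ k ∧
      (∀ e ∈ E, P e.1 e.2.1 e.2.2 ≠ 0) ∧ S.Nonempty ∧ min n (k + 1) ≤ S.card ∧
      ∀ (W : ℕ → Matrix (Fin n) (Fin n) ℝ) (δ : ℝ), 0 ≤ δ →
        (∀ t, IsLazyColStochastic δ (W t)) → (∀ e ∈ E, δ ≤ W e.1 e.2.1 e.2.2) →
        ∀ u : ℕ → Fin n → ℝ, (∀ t, u (t + 1) = (W t).mulVec (u t)) → (∀ i, 0 ≤ u (w * B) i) →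
        ∀ i ∈ S, δ ^ (k * B) * u (w * B) j ≤ u ((w + k) * B) i := by
  induction k with
  | zero =>
    refine ⟨∅, {j}, by simp, by simp, by simp, by simp, ?_⟩
    intro W δ _ _ _ u _ _ i hi
    simp [Finset.mem_singleton.1 hi]
  | succ k ih =>
    obtain ⟨E, S, hE, hEP, hS, hcard, hmain⟩ := ih
    have persist : ∀ (W : ℕ → Matrix (Fin n) (Fin n) ℝ) (δ : ℝ), 0 ≤ δ →
        (∀ t, IsLazyColStochastic δ (W t)) → (∀ e ∈ E, δ ≤ W e.1 e.2.1 e.2.2) →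
        ∀ u : ℕ → Fin n → ℝ, (∀ t, u (t + 1) = (W t).mulVec (u t)) → (∀ i, 0 ≤ u (w * B) i) →
        ∀ i ∈ S, ∀ r, δ ^ (k * B + r) * u (w * B) j ≤ u ((w + k) * B + r) i := by
      intro W δ hδ hW hWE u hu hu0 i hi r
      have h1 := hmain W δ hδ hW hWE u hu hu0 i hi
      have h2 := pow_mul_le_trajectory hδ hW hu (t := (w + k) * B)
        (trajectory_nonneg hW hu (Nat.mul_le_mul_right B (Nat.le_add_right w k)) hu0) i r
      calc δ ^ (k * B + r) * u (w * B) j = δ ^ r * (δ ^ (k * B) * u (w * B) j) := by ring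
        _ ≤ δ ^ r * u ((w + k) * B) i := mul_le_mul_of_nonneg_left h1 (pow_nonneg hδ r)
        _ ≤ _ := h2
    have eB1 : (k + 1) * B = k * B + B := by ring
    have eB2 : (w + (k + 1)) * B = (w + k) * B + B := by ring
    by_cases hSu : S = Finset.univ
    · refine ⟨E, S, by omega, hEP, hS, by simp [hSu], ?_⟩
      intro W δ hδ hW hWE u hu hu0 i hi
      rw [eB1, eB2]
      exact persist W δ hδ hW hWE u hu hu0 i hi B
    -- Window `w + k` offers a link from a reached node `b` to a new node `a`, active at some time
    -- `τ` of the window.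
    · obtain ⟨a, b, ha, hb, hab⟩ := exists_pos_entry_of_isIrreducible (hP.irreducible (w + k)) hS hSu
      rw [Matrix.sum_apply] at hab
      obtain ⟨τ, hτ, hτP⟩ := Finset.exists_ne_zero_of_sum_ne_zero hab.ne'
      rw [Finset.mem_Ico] at hτ
      refine ⟨insert (τ, a, b) E, insert a S, (Finset.card_insert_le _ _).trans (by omega), ?_,
        by simp, ?_, ?_⟩
      · intro e he
        rcases Finset.mem_insert.1 he with rfl | he
        · exact hτP
        · exact hEP e he
      · rw [Finset.card_insert_of_notMem ha]
        omega
      · intro W δ hδ hW hWE u hu hu0 i hi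
        have hWE' : ∀ e ∈ E, δ ≤ W e.1 e.2.1 e.2.2 := fun e he =>
          hWE e (Finset.mem_insert_of_mem he)
        rw [eB1, eB2]
        rcases Finset.mem_insert.1 hi with rfl | hi
        -- Mass waits `r` steps at `b`, crosses the link, then waits `q` steps at the new node, with
        -- `r + 1 + q = B`. Each step costs at most a factor `δ`.
        · obtain ⟨r, rfl⟩ := Nat.exists_eq_add_of_le hτ.1
          have hτ2 := hτ.2
          have e3 : (w + k + 1) * B = (w + k) * B + B := by ring
          obtain ⟨q, hq⟩ := Nat.exists_eq_add_of_le (show r + 1 ≤ B by omega)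
          have hnn : ∀ {t}, w * B ≤ t → ∀ l, 0 ≤ u t l := fun h => trajectory_nonneg hW hu h hu0
          have hwk : w * B ≤ (w + k) * B := Nat.mul_le_mul_right B (Nat.le_add_right w k)
          have h1 := persist W δ hδ hW hWE' u hu hu0 b hb r
          have h2 := mul_le_trajectory_succ hW hu (t := (w + k) * B + r) (hnn (by omega))
            (hWE ((w + k) * B + r, i, b) (Finset.mem_insert_self _ _))
          have h3 := pow_mul_le_trajectory hδ hW hu (t := (w + k) * B + r + 1) (hnn (by omega)) i q
          have e4 : k * B + B = (k * B + r) + (1 + q) := by omega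
          have e5 : (w + k) * B + B = (w + k) * B + r + 1 + q := by omega
          rw [e4, e5]
          calc δ ^ (k * B + r + (1 + q)) * u (w * B) j
              = δ ^ q * (δ * (δ ^ (k * B + r) * u (w * B) j)) := by ring
            _ ≤ δ ^ q * (δ * u ((w + k) * B + r) b) := by gcongr
            _ ≤ δ ^ q * u ((w + k) * B + r + 1) i :=
              mul_le_mul_of_nonneg_left h2 (pow_nonneg hδ q)
            _ ≤ _ := h3
        · exact persist W δ hδ hW hWE' u hu hu0 i hi B

/-- Starting at the window `w`, there are `n * n` possible links whose simultaneous presence carries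
the mass of every node to every node within `n` windows. -/
theorem exists_spreading_links {n : ℕ} {P : ℕ → Matrix (Fin n) (Fin n) ℝ} {ε : ℝ} {B : ℕ}
    (hP : IsBIrreducible P ε B) (w : ℕ) :
    ∃ E : Finset (ℕ × Fin n × Fin n), E.card ≤ n * n ∧ (∀ e ∈ E, P e.1 e.2.1 e.2.2 ≠ 0) ∧
      ∀ (W : ℕ → Matrix (Fin n) (Fin n) ℝ) (δ : ℝ), 0 ≤ δ →
        (∀ t, IsLazyColStochastic δ (W t)) → (∀ e ∈ E, δ ≤ W e.1 e.2.1 e.2.2) →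
        ∀ u : ℕ → Fin n → ℝ, (∀ t, u (t + 1) = (W t).mulVec (u t)) → (∀ i, 0 ≤ u (w * B) i) →
        ∀ i j, δ ^ (n * B) * u (w * B) j ≤ u ((w + n) * B) i := by
  choose E S hE hEP _ hcard hmain using fun j => exists_spreading_links_from hP w j n
  refine ⟨Finset.univ.biUnion E, ?_, ?_, ?_⟩
  · simpa using Finset.card_biUnion_le_card_mul Finset.univ E n fun j _ => hE j
  · intro e he
    obtain ⟨j, -, hj⟩ := Finset.mem_biUnion.1 he
    exact hEP j e hj
  · intro W δ hδ hW hWE u hu hu0 i j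
    have hSj : S j = Finset.univ := by
      rw [← Finset.card_eq_iff_eq_univ, Fintype.card_fin]
      have h1 := hcard j
      have h2 := Finset.card_le_univ (S j)
      rw [Fintype.card_fin] at h2
      omega
    exact hmain j W δ hδ hW
      (fun e he => hWE e (Finset.mem_biUnion.2 ⟨j, Finset.mem_univ j, he⟩)) u hu hu0 i
      (hSj ▸ Finset.mem_univ i)

/-! ### Contraction of the bracket -/

/-- The ratios `x_i(t) / y_i(t)` lie in `[a, b]`. -/
def Brackets {n : ℕ} (W : ℕ → Matrix (Fin n) (Fin n) ℝ) (x0 : Fin n → ℝ) (t : ℕ) (a b : ℝ) : Prop :=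
  ∀ i, 0 ≤ state W x0 t i - a * state W (fun _ => 1) t i ∧
    0 ≤ b * state W (fun _ => 1) t i - state W x0 t i

section contraction

variable {n : ℕ} {δ : ℝ} {W : ℕ → Matrix (Fin n) (Fin n) ℝ} {x0 : Fin n → ℝ}

theorem lower_gap_succ (W : ℕ → Matrix (Fin n) (Fin n) ℝ) (x0 : Fin n → ℝ) (a : ℝ) (t : ℕ) :
    (fun i => state W x0 (t + 1) i - a * state W (fun _ => 1) (t + 1) i) =
      (W t).mulVec fun i => state W x0 t i - a * state W (fun _ => 1) t i := by
  ext i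
  simp only [state, Matrix.mulVec, dotProduct, mul_sub, Finset.sum_sub_distrib, Finset.mul_sum]
  congr 1
  exact Finset.sum_congr rfl fun j _ => by ring

theorem upper_gap_succ (W : ℕ → Matrix (Fin n) (Fin n) ℝ) (x0 : Fin n → ℝ) (b : ℝ) (t : ℕ) :
    (fun i => b * state W (fun _ => 1) (t + 1) i - state W x0 (t + 1) i) =
      (W t).mulVec fun i => b * state W (fun _ => 1) t i - state W x0 t i := by
  ext i
  simp only [state, Matrix.mulVec, dotProduct, mul_sub, Finset.sum_sub_distrib, Finset.mul_sum]
  congr 1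
  exact Finset.sum_congr rfl fun j _ => by ring

theorem Brackets.mono (hW : ∀ t, IsLazyColStochastic δ (W t)) {s t : ℕ} (hst : s ≤ t) {a b : ℝ}
    (h : Brackets W x0 s a b) : Brackets W x0 t a b := fun i =>
  ⟨trajectory_nonneg (u := fun t i => state W x0 t i - a * state W (fun _ => 1) t i) hW
      (lower_gap_succ W x0 a) hst (fun i => (h i).1) i,
    trajectory_nonneg (u := fun t i => b * state W (fun _ => 1) t i - state W x0 t i) hW
      (upper_gap_succ W x0 b) hst (fun i => (h i).2) i⟩

theorem brackets_zero (x0 : Fin n → ℝ) :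
    Brackets W x0 0 (-∑ i, |x0 i|) (∑ i, |x0 i|) := by
  intro i
  have h := Finset.single_le_sum (f := fun i => |x0 i|) (fun j _ => abs_nonneg _)
    (Finset.mem_univ i)
  simp only [state, mul_one]
  have h1 := le_abs_self (x0 i)
  have h2 := neg_abs_le (x0 i)
  constructor <;> linarith

theorem state_one_pos (hδ : 0 < δ) (hW : ∀ t, IsLazyColStochastic δ (W t)) (t : ℕ) (i : Fin n) :
    0 < state W (fun _ => 1) t i := by
  have h := pow_mul_le_trajectory (u := state W fun _ => 1) hδ.le hW (fun _ => rfl) (t := 0)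
    (fun _ => zero_le_one) i t
  rw [zero_add] at h
  exact (mul_pos (pow_pos hδ t) zero_lt_one).trans_le h

theorem sum_state_one (hW : ∀ t, IsLazyColStochastic δ (W t)) (t : ℕ) :
    ∑ i, state W (fun _ => 1) t i = n := by
  rw [sum_trajectory (u := state W fun _ => 1) hW (fun _ => rfl) t]
  simp [state]

/-- If the mass of every node reaches every node by a factor at least `κ`, the bracket shrinks by the
factor `1 - κ / n`. -/
theorem Brackets.contract (hδ : 0 < δ) (hW : ∀ t, IsLazyColStochastic δ (W t)) {s s' : ℕ} {κ : ℝ}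
    (hκ : 0 ≤ κ)
    (hmix : ∀ u : ℕ → Fin n → ℝ, (∀ t, u (t + 1) = (W t).mulVec (u t)) → (∀ i, 0 ≤ u s i) →
      ∀ i j, κ * u s j ≤ u s' i) {a b : ℝ} (h : Brackets W x0 s a b) :
    ∃ a' b', Brackets W x0 s' a' b' ∧ b' - a' = (b - a) * (1 - κ / n) := by
  rcases Nat.eq_zero_or_pos n with rfl | hn
  · exact ⟨a, b, fun i => i.elim0, by simp⟩
  have hn' : (0 : ℝ) < n := Nat.cast_pos.2 hn
  set y : ℕ → Fin n → ℝ := state W fun _ => 1 with hy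
  have hyn : ∀ i, y s' i ≤ n := fun i => by
    rw [← sum_state_one hW s']
    exact Finset.single_le_sum (f := fun i => y s' i)
      (fun j _ => (state_one_pos hδ hW s' j).le) (Finset.mem_univ i)
  -- As `y s' i ≤ n`, the spread mass dominates a multiple of `y s'`, which the bracket's endpoint
  -- can absorb.
  have gap : ∀ u : ℕ → Fin n → ℝ, (∀ t, u (t + 1) = (W t).mulVec (u t)) → (∀ i, 0 ≤ u s i) →
      ∀ i, (κ / n * ((∑ j, u s j) / n)) * y s' i ≤ u s' i := by
    intro u hu hu0 i
    have hsum : κ * ∑ j, u s j ≤ n * u s' i := by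
      rw [Finset.mul_sum]
      simpa using Finset.sum_le_sum fun j (_ : j ∈ Finset.univ) => hmix u hu hu0 i j
    have hU : 0 ≤ ∑ j, u s j := Finset.sum_nonneg fun j _ => hu0 j
    calc (κ / n * ((∑ j, u s j) / n)) * y s' i ≤ (κ / n * ((∑ j, u s j) / n)) * n :=
          mul_le_mul_of_nonneg_left (hyn i) (by positivity)
      _ = (κ * ∑ j, u s j) / n := by field_simp
      _ ≤ u s' i := by rw [div_le_iff₀ hn']; linarith
  have h1 := gap (fun t i => state W x0 t i - a * y t i) (lower_gap_succ W x0 a) fun i => (h i).1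
  have h2 := gap (fun t i => b * y t i - state W x0 t i) (upper_gap_succ W x0 b) fun i => (h i).2
  -- The two gaps add up to `(b - a) y`, whose mean is `b - a` because `y` has total mass `n`. Hence
  -- the endpoints approach each other by exactly `κ / n * (b - a)`.
  refine ⟨a + κ / n * ((∑ j, (state W x0 s j - a * y s j)) / n),
    b - κ / n * ((∑ j, (b * y s j - state W x0 s j)) / n), fun i => ⟨?_, ?_⟩, ?_⟩
  · linarith [h1 i]
  · linarith [h2 i]
  · simp only [Finset.sum_sub_distrib, ← Finset.mul_sum, hy, sum_state_one hW s]
    field_simp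
    ring

theorem Brackets.abs_estimate_sub_average_le (hn : 0 < n) (hδ : 0 < δ)
    (hW : ∀ t, IsLazyColStochastic δ (W t)) {t : ℕ} {a b : ℝ} (h : Brackets W x0 t a b)
    (i : Fin n) : |estimate W x0 t i - average x0| ≤ b - a := by
  have hn' : (0 : ℝ) < n := Nat.cast_pos.2 hn
  have hy := state_one_pos hδ hW t i
  have h1 : a ≤ estimate W x0 t i := (le_div_iff₀ hy).2 (by linarith [(h i).1])
  have h2 : estimate W x0 t i ≤ b := (div_le_iff₀ hy).2 (by linarith [(h i).2])
  have hx : ∑ i, state W x0 t i = ∑ i, x0 i := sum_trajectory (u := state W x0) hW (fun _ => rfl) t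
  have h3 := Finset.sum_nonneg fun i (_ : i ∈ Finset.univ) => (h i).1
  have h4 := Finset.sum_nonneg fun i (_ : i ∈ Finset.univ) => (h i).2
  simp only [Finset.sum_sub_distrib, ← Finset.mul_sum, sum_state_one hW t, hx] at h3 h4
  have h5 : a ≤ average x0 := (le_div_iff₀ hn').2 (by linarith)
  have h6 : average x0 ≤ b := (div_le_iff₀ hn').2 (by linarith)
  rw [abs_le]
  constructor <;> linarith

end contraction

theorem IsBIrreducible.eps_le_one {n : ℕ} {P : ℕ → Matrix (Fin n) (Fin n) ℝ} {ε : ℝ} {B : ℕ}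
    (hP : IsBIrreducible P ε B) (i : Fin n) : ε ≤ 1 := by
  have h := hP.eps_le 0 i i (by rw [hP.diag]; exact one_ne_zero)
  rwa [hP.diag] at h

/-! ### Push-sum weights -/

section weight

variable {Ω : Type*} {n : ℕ} {R : ℕ → Fin n → Fin n → Ω → ℝ} {ω : Ω} {t : ℕ}

theorem inv_le_weight (h01 : ∀ i j, R t i j ω = 0 ∨ R t i j ω = 1) {a b : Fin n}
    (hab : R t a b ω = 1) : (n : ℝ)⁻¹ ≤ weight R ω t a b := by
  have hnn : ∀ i j, 0 ≤ R t i j ω := fun i j => by rcases h01 i j with h | h <;> simp [h]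
  have hle : ∑ k, R t k b ω ≤ n := by
    calc ∑ k, R t k b ω ≤ ∑ _k : Fin n, (1 : ℝ) :=
          Finset.sum_le_sum fun k _ => by rcases h01 k b with h | h <;> simp [h]
      _ = n := by simp
  have hpos : 0 < ∑ k, R t k b ω :=
    (hab ▸ zero_lt_one : 0 < R t a b ω).trans_le
      (Finset.single_le_sum (f := fun k => R t k b ω) (fun k _ => hnn k b) (Finset.mem_univ a))
  simp only [weight, Matrix.of_apply, hab, one_div]
  exact inv_anti₀ hpos hle

theorem isLazyColStochastic_weight (h01 : ∀ i j, R t i j ω = 0 ∨ R t i j ω = 1)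
    (hdiag : ∀ j, R t j j ω = 1) : IsLazyColStochastic (n : ℝ)⁻¹ (weight R ω t) := by
  have hnn : ∀ i j, 0 ≤ R t i j ω := fun i j => by rcases h01 i j with h | h <;> simp [h]
  refine ⟨fun i j => div_nonneg (hnn i j) (Finset.sum_nonneg fun k _ => hnn k j), fun j => ?_,
    fun j => inv_le_weight h01 (hdiag j)⟩
  have hpos : 0 < ∑ k, R t k j ω :=
    (hdiag j ▸ zero_lt_one : 0 < R t j j ω).trans_le
      (Finset.single_le_sum (f := fun k => R t k j ω) (fun k _ => hnn k j) (Finset.mem_univ j))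
  simp only [weight, Matrix.of_apply, ← Finset.sum_div]
  exact div_self hpos.ne'

end weight

/-! ### Probability of the links -/

section probability

variable {Ω : Type*} [MeasurableSpace Ω] {μ : Measure Ω} {n : ℕ}
  {P : ℕ → Matrix (Fin n) (Fin n) ℝ} {ε : ℝ} {B : ℕ} {R : ℕ → Fin n → Fin n → Ω → ℝ}

/-- The event that all the links in `E` are present. -/
def linksPresent (R : ℕ → Fin n → Fin n → Ω → ℝ) (E : Finset (ℕ × Fin n × Fin n)) : Set Ω :=
  ⋂ e ∈ E, R e.1 e.2.1 e.2.2 ⁻¹' {1}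

theorem measurableSet_linksPresent (hR : IsIndepBernoulli μ P R)
    (E : Finset (ℕ × Fin n × Fin n)) : MeasurableSet (linksPresent R E) :=
  Finset.measurableSet_biInter E fun e _ => hR.measurable e.1 e.2.1 e.2.2 (measurableSet_singleton 1)

theorem pow_le_measureReal_linksPresent (hP : IsBIrreducible P ε B)
    (hR : IsIndepBernoulli μ P R) (hε : ε ≤ 1) {E : Finset (ℕ × Fin n × Fin n)} {m : ℕ}
    (hE : E.card ≤ m) (hEP : ∀ e ∈ E, P e.1 e.2.1 e.2.2 ≠ 0) :
    ε ^ m ≤ μ.real (linksPresent R E) := by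
  have h := hR.indep.measure_inter_preimage_eq_mul E (sets := fun _ => {1})
    fun _ _ => measurableSet_singleton 1
  have h' : μ.real (linksPresent R E) = ∏ e ∈ E, P e.1 e.2.1 e.2.2 := by
    rw [measureReal_def, linksPresent, h, ENNReal.toReal_prod]
    refine Finset.prod_congr rfl fun e _ => ?_
    have h1 : μ (R e.1 e.2.1 e.2.2 ⁻¹' {1}) = ENNReal.ofReal (P e.1 e.2.1 e.2.2) :=
      hR.prob_one e.1 e.2.1 e.2.2
    rw [h1, ENNReal.toReal_ofReal (hP.nonneg _ _ _)]
  rw [h']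
  calc ε ^ m ≤ ε ^ E.card := pow_le_pow_of_le_one hP.eps_pos.le hε hE
    _ ≤ ∏ e ∈ E, P e.1 e.2.1 e.2.2 := by
      rw [← Finset.prod_const]
      exact Finset.prod_le_prod (fun _ _ => hP.eps_pos.le) fun e he => hP.eps_le _ _ _ (hEP e he)

theorem ae_links_zero_or_one [IsProbabilityMeasure μ] (hP : IsBIrreducible P ε B)
    (hR : IsIndepBernoulli μ P R) : ∀ᵐ ω ∂μ, ∀ t i j, R t i j ω = 0 ∨ R t i j ω = 1 := by
  simp only [ae_all_iff]
  intro t i j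
  have hm1 : MeasurableSet {ω | R t i j ω = 1} := hR.measurable t i j (measurableSet_singleton 1)
  have hm0 : MeasurableSet {ω | R t i j ω = 0} := hR.measurable t i j (measurableSet_singleton 0)
  have hd : Disjoint {ω | R t i j ω = 0} {ω | R t i j ω = 1} :=
    Set.disjoint_left.2 fun ω (h0 : R t i j ω = 0) (h1 : R t i j ω = 1) => by simp [h0] at h1
  have hu : μ ({ω | R t i j ω = 0} ∪ {ω | R t i j ω = 1}) = 1 := by
    rw [measure_union hd hm1, hR.prob_zero, hR.prob_one,
      ← ENNReal.ofReal_add (by linarith [hP.le_one t i j]) (hP.nonneg t i j)]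
    simp
  exact (mem_ae_iff_prob_eq_one (hm0.union hm1)).2 hu

theorem ae_links_diag [IsProbabilityMeasure μ] (hP : IsBIrreducible P ε B)
    (hR : IsIndepBernoulli μ P R) : ∀ᵐ ω ∂μ, ∀ t j, R t j j ω = 1 := by
  simp only [ae_all_iff]
  intro t j
  have hm1 : MeasurableSet {ω | R t j j ω = 1} := hR.measurable t j j (measurableSet_singleton 1)
  refine (mem_ae_iff_prob_eq_one hm1).2 ?_
  rw [hR.prob_one, hP.diag, ENNReal.ofReal_one]

end probability

/-! ### Extended-real expectations -/

section expectation

variable {Ω : Type*} [MeasurableSpace Ω] {μ : Measure Ω}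

theorem eln_of_pos {r : ℝ} (hr : 0 < r) : eln r = (Real.log r : EReal) :=
  ENNReal.log_ofReal_of_pos hr

theorem eln_mono {r s : ℝ} (h : r ≤ s) : eln r ≤ eln s :=
  ENNReal.log_monotone (ENNReal.ofReal_le_ofReal h)

theorem posExpectation_lt_top_of_ae_le {f : Ω → EReal} {G : Ω → ℝ} (hG : Integrable G μ)
    (h : ∀ᵐ ω ∂μ, f ω ≤ (G ω : EReal)) : posExpectation μ f < ⊤ := by
  refine lt_of_le_of_lt (lintegral_mono_ae (g := fun ω => ENNReal.ofReal (G ω)) ?_)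
    hG.lintegral_lt_top
  filter_upwards [h] with ω hω
  simpa [EReal.toENNReal_of_ne_top] using EReal.toENNReal_le_toENNReal hω

/-- Positive and negative parts are compared separately by monotonicity of the lower integral, so
`f` need not be measurable and `E[f⁻]` may be infinite. -/
theorem expectation_le_integral_of_ae_le {f : Ω → EReal} {G : Ω → ℝ} (hG : Integrable G μ)
    (h : ∀ᵐ ω ∂μ, f ω ≤ (G ω : EReal)) :
    expectation μ f ≤ ((∫ ω, G ω ∂μ : ℝ) : EReal) := by
  have h1 : posExpectation μ f ≤ ∫⁻ ω, ENNReal.ofReal (G ω) ∂μ := by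
    refine lintegral_mono_ae ?_
    filter_upwards [h] with ω hω
    simpa [EReal.toENNReal_of_ne_top] using EReal.toENNReal_le_toENNReal hω
  have h2 : ∫⁻ ω, ENNReal.ofReal (-G ω) ∂μ ≤ negExpectation μ f := by
    refine lintegral_mono_ae ?_
    filter_upwards [h] with ω hω
    have := EReal.toENNReal_le_toENNReal (EReal.neg_le_neg_iff.2 hω)
    rwa [← EReal.coe_neg, EReal.toENNReal_of_ne_top (EReal.coe_ne_top _), EReal.toReal_coe] at this
  have e1 := hG.lintegral_lt_top.ne
  have e2 : ∫⁻ ω, ENNReal.ofReal (-G ω) ∂μ ≠ ⊤ := hG.neg.lintegral_lt_top.ne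
  rw [integral_eq_lintegral_pos_part_sub_lintegral_neg_part hG, EReal.coe_sub,
    EReal.coe_ennreal_toReal e1, EReal.coe_ennreal_toReal e2]
  exact EReal.sub_le_sub (EReal.coe_ennreal_le_coe_ennreal_iff.2 h1)
    (EReal.coe_ennreal_le_coe_ennreal_iff.2 h2)

end expectation

/-! ### Comparison with the stated rate -/

section rate

variable {n B : ℕ} {ε : ℝ}

/-- Half of the exponent `4nB/p` absorbs `ε^(-n * n)`, via `x ≤ exp x` and `2 B log n ≥ 1`; the
other half absorbs `n^(nB + 1)`. -/
theorem inv_pow_mul_le_rpow (hn : 2 ≤ n) (hB : 0 < B) (h0 : 0 < ε) (h1 : ε ≤ 1) :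
    (ε ^ (n * n) * (((n : ℝ)⁻¹) ^ (n * B) / n))⁻¹ ≤ (n : ℝ) ^ (4 * (n : ℝ) * B / rateP n ε) := by
  have hp0 : 0 < rateP n ε := pow_pos h0 _
  have hp1 : rateP n ε ≤ 1 := pow_le_one₀ h0.le h1
  have hn2 : (2 : ℝ) ≤ n := by exact_mod_cast hn
  have hB1 : (1 : ℝ) ≤ B := by exact_mod_cast hB
  have hn0 : (0 : ℝ) < n := by linarith
  have hlog : 1 / 2 ≤ Real.log n := by
    have := Real.log_two_gt_d9
    have := Real.log_le_log two_pos hn2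
    linarith
  have hq : (ε ^ (n * n))⁻¹ ≤ (n : ℝ) ^ (2 * (n : ℝ) * B / rateP n ε) := by
    calc (ε ^ (n * n))⁻¹ ≤ (ε ^ (2 * (n - 1) * n))⁻¹ := by
          refine inv_anti₀ (pow_pos h0 _) (pow_le_pow_of_le_one h0.le h1 ?_)
          exact Nat.mul_le_mul_right n (by omega)
      _ = ((rateP n ε)⁻¹) ^ n := by rw [pow_mul, rateP, inv_pow]
      _ ≤ Real.exp ((rateP n ε)⁻¹) ^ n :=
          pow_le_pow_left₀ (inv_nonneg.2 hp0.le)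
            ((le_add_of_nonneg_right zero_le_one).trans (Real.add_one_le_exp _)) n
      _ = Real.exp (n * (rateP n ε)⁻¹) := (Real.exp_nat_mul _ n).symm
      _ ≤ _ := by
          rw [Real.rpow_def_of_pos hn0, Real.exp_le_exp]
          have h2 : 1 ≤ 2 * B * Real.log n := by nlinarith
          have h3 : 0 ≤ n * (rateP n ε)⁻¹ := by positivity
          calc n * (rateP n ε)⁻¹ ≤ (n * (rateP n ε)⁻¹) * (2 * B * Real.log n) :=
                le_mul_of_one_le_right h3 h2
            _ = _ := by ring
  have ha : ((((n : ℝ)⁻¹) ^ (n * B) / n))⁻¹ ≤ (n : ℝ) ^ (2 * (n : ℝ) * B / rateP n ε) := by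
    have e : ((((n : ℝ)⁻¹) ^ (n * B) / n))⁻¹ = (n : ℝ) ^ ((n * B + 1 : ℕ) : ℝ) := by
      rw [Real.rpow_natCast, pow_succ, inv_pow, div_eq_mul_inv, mul_inv, inv_inv, inv_inv]
    rw [e]
    refine Real.rpow_le_rpow_of_exponent_le (by linarith) ?_
    rw [le_div_iff₀ hp0]
    push_cast
    have h4 : (1 : ℝ) ≤ n * B := by nlinarith
    nlinarith
  rw [mul_inv]
  calc _ ≤ (n : ℝ) ^ (2 * (n : ℝ) * B / rateP n ε) * (n : ℝ) ^ (2 * (n : ℝ) * B / rateP n ε) :=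
        mul_le_mul hq ha (by positivity) (by positivity)
    _ = _ := by
        rw [← Real.rpow_add hn0]
        ring_nf

theorem neg_log_one_sub_le {x : ℝ} (h0 : 0 ≤ x) (h1 : x ≤ 1 / 2) :
    -Real.log (1 - x) ≤ 2 * x := by
  have h := Real.one_sub_inv_le_log_of_pos (show 0 < 1 - x by linarith)
  have h2 : (1 - x)⁻¹ ≤ 1 + 2 * x := by
    rw [inv_le_iff_one_le_mul₀ (by linarith)]
    nlinarith
  linarith

/-- With `q = ε^(n * n)`, linearizing both logarithms gives `c₁ t ≤ (m + 1) q α` and `q α ≤ -q log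
(1 - α)`. The incomplete last block costs `q α ≤ 1`. -/
theorem c1_mul_le (hn : 2 ≤ n) (hB : 0 < B) (h0 : 0 < ε) (h1 : ε ≤ 1) {t m : ℕ}
    (ht : t ≤ n * B * (m + 1)) :
    c1 n ε B * t ≤
      1 - m * (ε ^ (n * n) * Real.log (1 - ((n : ℝ)⁻¹) ^ (n * B) / n)) := by
  have hp0 : 0 < rateP n ε := pow_pos h0 _
  have hp1 : rateP n ε ≤ 1 := pow_le_one₀ h0.le h1
  have hn2 : (2 : ℝ) ≤ n := by exact_mod_cast hn
  have hB1 : (1 : ℝ) ≤ B := by exact_mod_cast hB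
  have hn0 : (0 : ℝ) < n := by linarith
  have hB0 : (0 : ℝ) < B := by linarith
  have hN := inv_pow_mul_le_rpow hn hB h0 h1
  unfold c1
  set N : ℝ := (n : ℝ) ^ (4 * (n : ℝ) * B / rateP n ε) with hNdef
  set q : ℝ := ε ^ (n * n) with hq
  set α : ℝ := ((n : ℝ)⁻¹) ^ (n * B) / n with hα
  have hq0 : 0 < q := pow_pos h0 _
  have hq1 : q ≤ 1 := pow_le_one₀ h0.le h1
  have hα0 : 0 < α := by positivity
  have hα2 : α ≤ 1 / 2 :=
    div_le_div₀ zero_le_one (pow_le_one₀ (by positivity) (inv_le_one_of_one_le₀ (by linarith)))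
      two_pos hn2
  have hNinv : 1 / N ≤ q * α := by
    rw [one_div]
    exact inv_le_of_inv_le₀ (by positivity) hN
  have hN0 : 0 ≤ 1 / N := by positivity
  have hlogN := neg_log_one_sub_le hN0 (hNinv.trans (by nlinarith))
  have hlogα : α ≤ -Real.log (1 - α) := by
    have := Real.log_le_sub_one_of_pos (show 0 < 1 - α by linarith)
    linarith
  have hT : (t : ℝ) ≤ n * B * (m + 1) := by exact_mod_cast ht
  have hnB : (0 : ℝ) < n * B := by positivity
  have hcoef : rateP n ε / (2 * n * B) * t ≤ (m + 1) / 2 := by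
    rw [div_mul_eq_mul_div, div_le_iff₀ (by positivity)]
    have : rateP n ε * t ≤ t := mul_le_of_le_one_left (Nat.cast_nonneg t) hp1
    linarith
  calc -(rateP n ε / (2 * n * B)) * Real.log (1 - 1 / N) * t
      = (rateP n ε / (2 * n * B) * t) * -Real.log (1 - 1 / N) := by ring
    _ ≤ (rateP n ε / (2 * n * B) * t) * (2 * (q * α)) :=
        mul_le_mul_of_nonneg_left (hlogN.trans (by linarith)) (by positivity)
    _ ≤ (m + 1) / 2 * (2 * (q * α)) := mul_le_mul_of_nonneg_right hcoef (by positivity)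
    _ = q * α + m * (q * α) := by ring
    _ ≤ 1 + m * (q * -Real.log (1 - α)) := by
        gcongr
        nlinarith
    _ = _ := by ring

end rate

/-- For each block of `n` windows choose links that, when present, contract the bracket. -/
theorem exists_contracting_links {Ω : Type*} {n : ℕ} {P : ℕ → Matrix (Fin n) (Fin n) ℝ} {ε : ℝ}
    {B : ℕ} (hP : IsBIrreducible P ε B) (hn : 0 < n) :
    ∃ E : ℕ → Finset (ℕ × Fin n × Fin n),
      (∀ k, (E k).card ≤ n * n ∧ ∀ e ∈ E k, P e.1 e.2.1 e.2.2 ≠ 0) ∧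
      ∀ (R : ℕ → Fin n → Fin n → Ω → ℝ) (x0 : Fin n → ℝ) (ω : Ω),
        (∀ t i j, R t i j ω = 0 ∨ R t i j ω = 1) → (∀ t j, R t j j ω = 1) →
        ∀ m, ∃ a b, Brackets (weight R ω) x0 (m * (n * B)) a b ∧
          b - a = 2 * (∑ i, |x0 i|) * ∏ k ∈ Finset.range m,
            (1 - (linksPresent R (E k)).indicator 1 ω * (((n : ℝ)⁻¹) ^ (n * B) / n)) := by
  choose E hcard hEP hmix using fun k => exists_spreading_links hP (k * n)
  refine ⟨E, fun k => ⟨hcard k, hEP k⟩, fun R x0 ω h01 hdiag m => ?_⟩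
  have hδ : (0 : ℝ) < (n : ℝ)⁻¹ := inv_pos.2 (Nat.cast_pos.2 hn)
  have hW : ∀ t, IsLazyColStochastic (n : ℝ)⁻¹ (weight R ω t) := fun t =>
    isLazyColStochastic_weight (h01 t) (hdiag t)
  induction m with
  | zero =>
    refine ⟨-∑ i, |x0 i|, ∑ i, |x0 i|, ?_, ?_⟩
    · rw [zero_mul]
      exact brackets_zero x0
    · simp only [Finset.range_zero, Finset.prod_empty]
      ring
  | succ m ih =>
    obtain ⟨a, b, hab, hlen⟩ := ih
    rw [Finset.prod_range_succ]
    by_cases hω : ω ∈ linksPresent R (E m)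
    · have e1 : m * n * B = m * (n * B) := by ring
      have e2 : (m * n + n) * B = (m + 1) * (n * B) := by ring
      have hmix' := hmix m (weight R ω) _ hδ.le hW fun e he =>
        inv_le_weight (h01 e.1) (Set.mem_iInter₂.1 hω e he)
      rw [e1, e2] at hmix'
      obtain ⟨a', b', hab', hlen'⟩ := hab.contract hδ hW (pow_nonneg hδ.le _) hmix'
      refine ⟨a', b', hab', ?_⟩
      rw [hlen', hlen, Set.indicator_of_mem hω, Pi.one_apply]
      ring
    · refine ⟨a, b, hab.mono hW (Nat.mul_le_mul_right _ (Nat.le_succ m)), ?_⟩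
      rw [hlen, Set.indicator_of_notMem hω]
      ring

theorem estimate_zero {n : ℕ} (W : ℕ → Matrix (Fin n) (Fin n) ℝ) (t : ℕ) (i : Fin n) :
    estimate W (fun _ => 0) t i = 0 := by
  have h : ∀ t, state W (fun _ => 0) t = fun _ => 0 := by
    intro t
    induction t with
    | zero => rfl
    | succ t ih =>
      rw [state, ih]
      exact Matrix.mulVec_zero _
  rw [estimate, h, zero_div]

theorem eln_zero : eln 0 = ⊥ := by simp [eln]

end PushSum

theorem mainTheorem1 {Ω : Type*} [MeasurableSpace Ω] (μ : Measure Ω) [IsProbabilityMeasure μ]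
    (n : ℕ) (hn : 2 ≤ n) (P : ℕ → Matrix (Fin n) (Fin n) ℝ) (ε : ℝ) (B : ℕ)
    (hP : PushSum.IsBIrreducible P ε B)
    (R : ℕ → Fin n → Fin n → Ω → ℝ) (hR : PushSum.IsIndepBernoulli μ P R)
    (x0 : Fin n → ℝ) (i : Fin n) (t : ℕ)
    (ht : (B : ℝ) + 2 * n * B / PushSum.rateP n ε ≤ t) :
    PushSum.posExpectation μ (fun ω => PushSum.eln
        |PushSum.estimate (PushSum.weight R ω) x0 (t + 1) i - PushSum.average x0|) < ⊤ ∧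
    PushSum.expectation μ (fun ω => PushSum.eln
        |PushSum.estimate (PushSum.weight R ω) x0 (t + 1) i - PushSum.average x0|)
      ≤ PushSum.c0 ε B x0 - ((PushSum.c1 n ε B * t : ℝ) : EReal) := by
  open PushSum in
  have hn0 : 0 < n := by omega
  have hn2 : (2 : ℝ) ≤ n := by exact_mod_cast hn
  -- For `x(0) = 0` the error vanishes identically, and the expectation is `-∞`.
  rcases (Finset.sum_nonneg fun i (_ : i ∈ Finset.univ) => abs_nonneg (x0 i)).eq_or_lt with hx | hx
  · have hx0 : x0 = fun _ => 0 := by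
      ext j
      exact abs_eq_zero.1 ((Finset.sum_eq_zero_iff_of_nonneg fun j _ => abs_nonneg (x0 j)).1 hx.symm j
        (Finset.mem_univ j))
    subst hx0
    simp [estimate_zero, PushSum.average, eln_zero, posExpectation, negExpectation, expectation]
  have hε := hP.eps_le_one i
  have hδ : (0 : ℝ) < (n : ℝ)⁻¹ := inv_pos.2 (Nat.cast_pos.2 hn0)
  obtain ⟨E, hE, hbr⟩ := exists_contracting_links (Ω := Ω) hP hn0
  set α : ℝ := ((n : ℝ)⁻¹) ^ (n * B) / n with hα
  have hα1 : 0 < 1 - α := by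
    have : α ≤ 1 / 2 :=
      div_le_div₀ zero_le_one (pow_le_one₀ hδ.le (inv_le_one_of_one_le₀ (by linarith)))
        two_pos hn2
    linarith
  have hα0 : 0 ≤ α := by positivity
  have hnB : 0 < n * B := Nat.mul_pos hn0 hP.window_pos
  -- The number of complete blocks up to time `t + 1`.
  set m := (t + 1) / (n * B) with hm
  have hm1 : m * (n * B) ≤ t + 1 := Nat.div_mul_le_self _ _
  have hm2 : t ≤ n * B * (m + 1) := by
    have h : t + 1 < n * B * (m + 1) := Nat.lt_mul_div_succ (t + 1) hnB
    omega
  let A : ℕ → Set Ω := fun k => linksPresent R (E k)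
  have hA : ∀ k, MeasurableSet (A k) := fun k => measurableSet_linksPresent hR (E k)
  let G : Ω → ℝ := fun ω => Real.log (2 * ∑ i, |x0 i|) +
    ∑ k ∈ Finset.range m, (A k).indicator (fun _ => Real.log (1 - α)) ω
  have hAint : ∀ k, Integrable ((A k).indicator fun _ => Real.log (1 - α)) μ := fun k =>
    (integrable_const _).indicator (hA k)
  have hsumint : Integrable
      (fun ω => ∑ k ∈ Finset.range m, (A k).indicator (fun _ => Real.log (1 - α)) ω) μ :=
    integrable_finsetSum _ fun k _ => hAint k
  have hG : Integrable G μ := (integrable_const _).add hsumint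
  have hle : ∀ᵐ ω ∂μ, eln |estimate (weight R ω) x0 (t + 1) i - average x0| ≤ (G ω : EReal) := by
    filter_upwards [ae_links_zero_or_one hP hR, ae_links_diag hP hR] with ω h01 hdiag
    have hW : ∀ t, IsLazyColStochastic (n : ℝ)⁻¹ (weight R ω t) := fun t =>
      isLazyColStochastic_weight (h01 t) (hdiag t)
    obtain ⟨a, b, hab, hlen⟩ := hbr R x0 ω h01 hdiag m
    have hfac : ∀ k, 0 < 1 - (A k).indicator 1 ω * α ∧
        Real.log (1 - (A k).indicator 1 ω * α) =
          (A k).indicator (fun _ => Real.log (1 - α)) ω := by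
      intro k
      by_cases hk : ω ∈ A k <;> simp [hk, hα1]
    have hprod : 0 < ∏ k ∈ Finset.range m, (1 - (A k).indicator 1 ω * α) :=
      Finset.prod_pos fun k _ => (hfac k).1
    refine (eln_mono ((hab.mono hW hm1).abs_estimate_sub_average_le hn0 hδ hW i)).trans ?_
    rw [hlen, eln_of_pos (mul_pos (by linarith) hprod),
      Real.log_mul (by linarith) hprod.ne', Real.log_prod fun k _ => (hfac k).1.ne',
      Finset.sum_congr rfl fun k _ => (hfac k).2]
  refine ⟨posExpectation_lt_top_of_ae_le hG hle,
    (expectation_le_integral_of_ae_le hG hle).trans ?_⟩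
  have hlog : Real.log (1 - α) ≤ 0 := Real.log_nonpos hα1.le (by linarith)
  have hI : ∫ ω, G ω ∂μ ≤
      Real.log (2 * ∑ i, |x0 i|) + m * (ε ^ (n * n) * Real.log (1 - α)) := by
    rw [integral_add (integrable_const _) hsumint, integral_finsetSum _ fun k _ => hAint k]
    simp only [integral_const, probReal_univ, one_smul]
    gcongr
    calc ∑ k ∈ Finset.range m, ∫ ω, (A k).indicator (fun _ => Real.log (1 - α)) ω ∂μ
        ≤ ∑ _k ∈ Finset.range m, ε ^ (n * n) * Real.log (1 - α) := by
          refine Finset.sum_le_sum fun k _ => ?_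
          -- Since `log (1 - α) ≤ 0`, the lower bound on the probability becomes an upper bound on
          -- the expectation.
          rw [integral_indicator_const _ (hA k), smul_eq_mul]
          exact mul_le_mul_of_nonpos_right
            (pow_le_measureReal_linksPresent hP hR hε (hE k).1 (hE k).2) hlog
      _ = _ := by simp
  have hc := c1_mul_le hn hP.window_pos hP.eps_pos hε hm2
  -- `log 15` pays for the additive `1` in `hc`; the `log n` term of `c₀` is only needed to be
  -- nonnegative.
  have h15 : 1 ≤ Real.log 15 := by
    rw [Real.le_log_iff_exp_le (by norm_num)]
    linarith [Real.exp_one_lt_d9]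
  have hslack : 0 ≤ Real.log n * ((n : ℝ) * B / rateP n ε + B) :=
    mul_nonneg (Real.log_nonneg (by linarith))
      (add_nonneg (div_nonneg (by positivity) (pow_nonneg hP.eps_pos.le _)) (by positivity))
  rw [c0, eln_of_pos (by linarith), ← EReal.coe_add, ← EReal.coe_sub, EReal.coe_le_coe_iff]
  linarith
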